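/- Let $n\ge 1$ be an integer and write $[n]=\{0,1,\dots,n-1\}$. A matching in $[n]$ is a set of pairwise disjoint two-element subsets of $[n]$. Let $\alpha\in(0,1)$ (allowed to depend on $n$), and let $\tilde q$ be a probability measure on the set of matchings in $[n]$ such that $$\mathbb P_{M\sim\tilde q}\bigl(\{i,j\}\in M\bigr)\;\ge\;\frac{\alpha}{|j-i|}\qquad\text{for all } i,j\in[n] \text{ with } i\ne j .$$ Let $M_1,M_2,\dots$ be independent random matchings with law $\tilde q$, and let $x\in\{0,1\}^{[n]}$ be an arbitrary $0$–$1$ sequence. The parallel sorter started from $X_0=x$ obtains $X_t$ from $X_{t-1}$ by sorting, for every pair $\{i,j\}\in M_t$ with $i<j$, the labels at positions $i$ and $j$ (the smaller label is put at position $i$, the larger one at position $j$), leaving the labels at all other positions unchanged. Let $\tau_\star=\inf\{t\ge 0: X_t \text{ is non-decreasing}\}$ be the sorting time. Then $$\mathbb P\bigl(\tau_\star>50\,(\log n)/\alpha\bigr)\;\le\;\frac1{n^2},$$ where $\log$ is the natural logarithm. -/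

import Mathlib

open MeasureTheory ProbabilityTheory

/-- A matching in `[n]`: a finite set of pairs of distinct positions, any two different pairs
being disjoint. The positions `[n]` are `Fin n = {0, …, n - 1}`. -/
structure Matching (n : ℕ) where
  edges : Finset (Sym2 (Fin n))
  not_diag : ∀ e ∈ edges, ¬ e.IsDiag
  disjoint : ∀ e ∈ edges, ∀ f ∈ edges, ∀ v : Fin n, v ∈ e → v ∈ f → e = f

/-- The set of matchings is finite and every set of matchings is an event. -/
instance Matching.instMeasurableSpace (n : ℕ) : MeasurableSpace (Matching n) := ⊤

/-- The position matched with `i` in `M`, and `i` itself if `i` is unmatched. -/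
noncomputable def Matching.mate {n : ℕ} (M : Matching n) (i : Fin n) : Fin n :=
  open Classical in
  if h : ∃ j, s(i, j) ∈ M.edges then h.choose else i

theorem Matching.mate_eq {n : ℕ} (M : Matching n) {i j : Fin n} (h : s(i, j) ∈ M.edges) :
    M.mate i = j := by
  have hex : ∃ j, s(i, j) ∈ M.edges := ⟨j, h⟩
  have hm : M.mate i = hex.choose := by
    unfold Matching.mate
    exact dif_pos hex
  rw [hm]
  have heq := M.disjoint _ hex.choose_spec _ h i (Sym2.mem_mk_left _ _) (Sym2.mem_mk_left _ _)
  exact Sym2.congr_right.mp heq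

/-- One round of the parallel sorter with matching `M`: for each pair `{i, j} ∈ M`, the smaller of
the two labels goes to the smaller position and the larger one to the larger position; labels at
unmatched positions stay (see `sortStep_left`, `sortStep_right`, `sortStep_of_unmatched`). -/
noncomputable def sortStep {n : ℕ} {L : Type*} [LinearOrder L] (M : Matching n) (x : Fin n → L) :
    Fin n → L :=
  fun i => if i ≤ M.mate i then min (x i) (x (M.mate i)) else max (x i) (x (M.mate i))

theorem sortStep_left {n : ℕ} {L : Type*} [LinearOrder L] (M : Matching n) (x : Fin n → L)
    {i j : Fin n} (h : s(i, j) ∈ M.edges) (hij : i < j) :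
    sortStep M x i = min (x i) (x j) := by
  simp [sortStep, M.mate_eq h, hij.le]

theorem sortStep_right {n : ℕ} {L : Type*} [LinearOrder L] (M : Matching n) (x : Fin n → L)
    {i j : Fin n} (h : s(i, j) ∈ M.edges) (hij : i < j) :
    sortStep M x j = max (x i) (x j) := by
  have h' : s(j, i) ∈ M.edges := by rwa [Sym2.eq_swap]
  simp [sortStep, M.mate_eq h', hij, max_comm]

theorem sortStep_of_unmatched {n : ℕ} {L : Type*} [LinearOrder L] (M : Matching n) (x : Fin n → L)
    {i : Fin n} (h : ∀ j, s(i, j) ∉ M.edges) :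
    sortStep M x i = x i := by
  have hm : M.mate i = i := by
    unfold Matching.mate
    exact dif_neg (fun ⟨j, hj⟩ => h j hj)
  simp [sortStep, hm]

/-- The state of the list, started from `x`, after the first `t` of the matchings
`m 0, m 1, m 2, …` have been processed in this order. -/
noncomputable def sorterState {n : ℕ} {L : Type*} [LinearOrder L] (m : ℕ → Matching n)
    (x : Fin n → L) : ℕ → Fin n → L
  | 0 => x
  | t + 1 => sortStep (m t) (sorterState m x t)

/-- The sorting time: the least `t` such that the list is sorted after `t` rounds
(`⊤` if it is never sorted). -/
noncomputable def sortingTime {n : ℕ} {L : Type*} [LinearOrder L] (m : ℕ → Matching n)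
    (x : Fin n → L) : ℕ∞ :=
  ⨅ t ∈ {t : ℕ | Monotone (sorterState m x t)}, (t : ℕ∞)

/-- The class `𝒬_α`: the probability measures on matchings of `[n]` for which every pair `{i, j}`
of distinct positions belongs to the random matching with probability at least `α / |j - i|`. -/
def MatchingClass (n : ℕ) (α : ℝ) : Set (Measure (Matching n)) :=
  {q | IsProbabilityMeasure q ∧ ∀ i j : Fin n, i ≠ j →
    α / |((j : ℕ) : ℝ) - ((i : ℕ) : ℝ)| ≤ q.real {M | s(i, j) ∈ M.edges}}

/-! A round that sorts the pair `{i, j}`, `i < j`, lowers the total inversion weight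
`∑ i < j, (x i - x j)⁺` by exactly `(j - i) * (x i - x j)⁺`, because this weight differs from
`-∑ i, i * x i` by a quantity that is invariant under permutations of the labels. Since `{i, j}` is
sorted with probability at least `α / (j - i)`, the two distances cancel, and each round multiplies
the expected inversion weight by at most `1 - α`. Replacing each label by its rank makes the labels
integers in `[0, n]`: the weight is then at most `n ^ 3`, and at least `1` unless the list is
sorted, so Markov's inequality bounds the probability that the list is not sorted after `t` rounds
by `(1 - α) ^ t * n ^ 3`. -/

section InversionWeight

variable {n : ℕ}

/-- The total size of the inversions of `x`. For a `0`-`1` sequence it is the number of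
inversions. -/
noncomputable def inversionWeight (x : Fin n → ℝ) : ℝ :=
  ∑ i, ∑ j ∈ Finset.Ioi i, (x i - x j)⁺

theorem inversionWeight_nonneg (x : Fin n → ℝ) : 0 ≤ inversionWeight x :=
  Finset.sum_nonneg fun _ _ ↦ Finset.sum_nonneg fun _ _ ↦ posPart_nonneg _

theorem inversionWeight_le {x : Fin n → ℝ} {B : ℝ} (hB : ∀ i j, x i - x j ≤ B) :
    inversionWeight x ≤ n ^ 2 * B := by
  have hpos (i j : Fin n) : (x i - x j)⁺ ≤ B :=
    sup_le (hB i j) (by simpa using hB i i)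
  calc inversionWeight x ≤ ∑ i : Fin n, ∑ j : Fin n, (x i - x j)⁺ :=
        Finset.sum_le_sum fun i _ ↦ Finset.sum_le_sum_of_subset_of_nonneg (Finset.subset_univ _)
          fun _ _ _ ↦ posPart_nonneg _
    _ ≤ ∑ _i : Fin n, ∑ _j : Fin n, B :=
        Finset.sum_le_sum fun i _ ↦ Finset.sum_le_sum fun j _ ↦ hpos i j
    _ = n ^ 2 * B := by simp [sq, mul_assoc]

theorem one_le_inversionWeight_natCast {x : Fin n → ℕ} (hx : ¬ Monotone x) :
    1 ≤ inversionWeight fun i ↦ (x i : ℝ) := by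
  obtain ⟨i, j, hij, hlt⟩ : ∃ i j, i ≤ j ∧ x j < x i := by simpa [Monotone] using hx
  have hij' : i < j := hij.lt_of_ne (by rintro rfl; exact hlt.false)
  have hgap : (x j : ℝ) + 1 ≤ x i := mod_cast hlt
  calc (1 : ℝ) ≤ ((x i : ℝ) - x j)⁺ := (by linarith : (1 : ℝ) ≤ x i - x j).trans (le_posPart _)
    _ ≤ ∑ j ∈ Finset.Ioi i, ((x i : ℝ) - x j)⁺ :=
        Finset.single_le_sum (f := fun j ↦ ((x i : ℝ) - x j)⁺) (fun _ _ ↦ posPart_nonneg _)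
          (Finset.mem_Ioi.2 hij')
    _ ≤ inversionWeight fun i ↦ (x i : ℝ) :=
        Finset.single_le_sum (f := fun i ↦ ∑ j ∈ Finset.Ioi i, ((x i : ℝ) - x j)⁺)
          (fun _ _ ↦ Finset.sum_nonneg fun _ _ ↦ posPart_nonneg _) (Finset.mem_univ i)

theorem sum_sum_Ioi_sub {R : Type*} [CommRing R] (x : Fin n → R) :
    ∑ i, ∑ j ∈ Finset.Ioi i, (x i - x j) = ∑ i : Fin n, ((n : R) - 1 - 2 * (i : ℕ)) * x i := by
  have hleft (i : Fin n) : ∑ _j ∈ Finset.Ioi i, x i = ((n : R) - 1 - (i : ℕ)) * x i := by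
    rw [Finset.sum_const, Fin.card_Ioi, nsmul_eq_mul, Nat.sub_sub, Nat.cast_sub (by omega)]
    push_cast
    ring
  have hright : ∑ i, ∑ j ∈ Finset.Ioi i, x j = ∑ j : Fin n, ((j : ℕ) : R) * x j := by
    rw [Finset.sum_comm' (t' := Finset.univ) (s' := Finset.Iio) (by simp)]
    simp
  simp only [Finset.sum_sub_distrib, hleft, hright]
  rw [← Finset.sum_sub_distrib]
  exact Finset.sum_congr rfl fun i _ ↦ by ring

theorem two_mul_inversionWeight (x : Fin n → ℝ) :
    2 * inversionWeight x
      = (∑ i, ∑ j, |x i - x j|) / 2 + ∑ i : Fin n, ((n : ℝ) - 1 - 2 * (i : ℕ)) * x i := by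
  have habs : ∑ i, ∑ j ∈ Finset.Ioi i, (|x j - x i| + |x i - x j|) = ∑ i, ∑ j, |x i - x j| := by
    rw [Finset.sum_sum_Ioi_add_eq_sum_sum_off_diag fun i j ↦ |x i - x j|]
    refine Finset.sum_congr rfl fun i _ ↦ ?_
    rw [← Finset.sum_add_sum_compl {i} fun j ↦ |x i - x j|]
    simp [abs_sub_comm]
  rw [← habs, ← sum_sum_Ioi_sub, inversionWeight]
  simp only [Finset.mul_sum, Finset.sum_div, ← Finset.sum_add_distrib]
  refine Finset.sum_congr rfl fun i _ ↦ Finset.sum_congr rfl fun j _ ↦ ?_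
  rw [abs_sub_comm (x j)]
  linarith [abs_add_eq_two_nsmul_posPart (x i - x j), two_nsmul (x i - x j)⁺]

theorem inversionWeight_comp_perm (x : Fin n → ℝ) (σ : Equiv.Perm (Fin n)) :
    inversionWeight (x ∘ σ)
      = inversionWeight x + ∑ i : Fin n, ((i : ℕ) : ℝ) * x i
        - ∑ i : Fin n, ((i : ℕ) : ℝ) * x (σ i) := by
  have habs : ∑ i, ∑ j, |x (σ i) - x (σ j)| = ∑ i, ∑ j, |x i - x j| := by
    rw [Equiv.sum_comp σ fun i ↦ ∑ j, |x i - x (σ j)|]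
    exact Finset.sum_congr rfl fun i _ ↦ Equiv.sum_comp σ fun j ↦ |x i - x j|
  have hsum : ∑ i, x (σ i) = ∑ i, x i := Equiv.sum_comp σ x
  have hx := two_mul_inversionWeight x
  have hσ := two_mul_inversionWeight (x ∘ σ)
  simp only [Function.comp_apply, sub_mul _ _ (x _), mul_assoc,
    Finset.sum_sub_distrib, ← Finset.mul_sum, habs, hsum] at hx hσ
  linarith

end InversionWeight

section Round

variable {n : ℕ} {L : Type*} [LinearOrder L]

theorem Matching.mate_mate (M : Matching n) (i : Fin n) : M.mate (M.mate i) = i := by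
  by_cases h : ∃ j, s(i, j) ∈ M.edges
  · obtain ⟨j, hj⟩ := h
    rw [M.mate_eq hj, M.mate_eq (Sym2.eq_swap ▸ hj)]
  · have hi : M.mate i = i := dif_neg h
    rw [hi, hi]

theorem Matching.mate_involutive (M : Matching n) : Function.Involutive M.mate :=
  M.mate_mate

theorem Matching.mem_edges_iff_mate_eq (M : Matching n) {i j : Fin n} (hij : i ≠ j) :
    s(i, j) ∈ M.edges ↔ M.mate i = j := by
  refine ⟨M.mate_eq, fun h ↦ ?_⟩
  by_cases hex : ∃ k, s(i, k) ∈ M.edges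
  · obtain ⟨k, hk⟩ := hex
    rwa [← h, M.mate_eq hk]
  · exact absurd ((dif_neg hex).symm.trans h) hij

theorem sortStep_mate_eq_iff (M : Matching n) (x : Fin n → L) (i : Fin n) :
    sortStep M x (M.mate i) = x (M.mate i) ↔ sortStep M x i = x i := by
  simp only [sortStep, M.mate_mate]
  rcases lt_trichotomy i (M.mate i) with h | h | h
  · simp [h.le, h.not_ge]
  · simp [← h]
  · simp [h.le, h.not_ge]

theorem sortStep_eq_or_eq_mate (M : Matching n) (x : Fin n → L) (i : Fin n) :
    sortStep M x i = x i ∨ sortStep M x i = x (M.mate i) := by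
  unfold sortStep
  split_ifs
  · exact min_choice _ _
  · exact max_choice _ _

theorem exists_perm_sortStep_eq_comp (M : Matching n) (x : Fin n → L) :
    ∃ σ : Equiv.Perm (Fin n), sortStep M x = x ∘ σ := by
  let σ : Fin n → Fin n := fun i ↦ if sortStep M x i = x i then i else M.mate i
  have hσ : Function.Involutive σ := fun i ↦ by
    by_cases h : sortStep M x i = x i
    · simp [σ, h]
    · simp [σ, h, sortStep_mate_eq_iff, M.mate_mate]
  refine ⟨hσ.toPerm, funext fun i ↦ ?_⟩
  by_cases h : sortStep M x i = x i
  · simp [σ, h]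
  · exact ((sortStep_eq_or_eq_mate M x i).resolve_left h).trans (by simp [σ, h])

theorem sortStep_comp_of_monotone {L' : Type*} [LinearOrder L'] {f : L → L'} (hf : Monotone f)
    (M : Matching n) (x : Fin n → L) : sortStep M (f ∘ x) = f ∘ sortStep M x := by
  funext i
  simp only [sortStep, Function.comp_apply]
  split_ifs
  · exact hf.map_min.symm
  · exact hf.map_max.symm

theorem sortStep_eq_sub_add (M : Matching n) (x : Fin n → ℝ) (i : Fin n) :
    sortStep M x i = x i - (if i < M.mate i then (x i - x (M.mate i))⁺ else 0)
      + (if M.mate i < i then (x (M.mate i) - x i)⁺ else 0) := by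
  rcases lt_trichotomy i (M.mate i) with h | h | h
  · simp [sortStep, h, h.le, h.not_gt, inf_eq_sub_posPart_sub]
  · simp [sortStep, ← h]
  · simp [sortStep, h, h.not_ge, h.not_gt, sup_comm (x i), sup_eq_add_posPart_sub]

theorem sum_mul_sortStep (M : Matching n) (w x : Fin n → ℝ) :
    ∑ i, w i * sortStep M x i = ∑ i, w i * x i + ∑ i, ∑ j ∈ Finset.Ioi i,
      if s(i, j) ∈ M.edges then (w j - w i) * (x i - x j)⁺ else 0 := by
  have hmate : ∑ i, w i * (if M.mate i < i then (x (M.mate i) - x i)⁺ else 0)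
      = ∑ i, w (M.mate i) * (if i < M.mate i then (x i - x (M.mate i))⁺ else 0) := by
    rw [← M.mate_involutive.bijective.sum_comp]
    simp only [M.mate_mate]
  have hedges (i : Fin n) :
      ∑ j ∈ Finset.Ioi i, (if s(i, j) ∈ M.edges then (w j - w i) * (x i - x j)⁺ else 0)
        = (w (M.mate i) - w i) * (if i < M.mate i then (x i - x (M.mate i))⁺ else 0) := by
    rw [Finset.sum_congr rfl fun j hj ↦ if_congr
      (M.mem_edges_iff_mate_eq (Finset.mem_Ioi.1 hj).ne) rfl rfl, Finset.sum_ite_eq]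
    simp
  simp only [sortStep_eq_sub_add, mul_add, mul_sub, Finset.sum_add_distrib,
    Finset.sum_sub_distrib, hmate, hedges]
  simp only [sub_mul, Finset.sum_sub_distrib]
  ring

theorem inversionWeight_sortStep (M : Matching n) (x : Fin n → ℝ) :
    inversionWeight (sortStep M x) = inversionWeight x - ∑ i : Fin n, ∑ j ∈ Finset.Ioi i,
      if s(i, j) ∈ M.edges then (((j : ℕ) : ℝ) - (i : ℕ)) * (x i - x j)⁺ else 0 := by
  obtain ⟨σ, hσ⟩ := exists_perm_sortStep_eq_comp M x
  have hsum := sum_mul_sortStep M (fun i ↦ ((i : ℕ) : ℝ)) x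
  simp only [hσ, Function.comp_apply] at hsum
  rw [hσ, inversionWeight_comp_perm, hsum]
  ring

end Round

section State

variable {n : ℕ} {L : Type*} [LinearOrder L]

theorem sorterState_comp_of_monotone {L' : Type*} [LinearOrder L'] {f : L → L'} (hf : Monotone f)
    (m : ℕ → Matching n) (x : Fin n → L) (t : ℕ) :
    sorterState m (f ∘ x) t = f ∘ sorterState m x t := by
  induction t with
  | zero => rfl
  | succ t ih => rw [sorterState, ih, sortStep_comp_of_monotone hf, sorterState]

theorem sorterState_mem_range (m : ℕ → Matching n) (x : Fin n → L) (t : ℕ) (i : Fin n) :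
    sorterState m x t i ∈ Set.range x := by
  induction t generalizing i with
  | zero => exact ⟨i, rfl⟩
  | succ t ih =>
    obtain ⟨σ, hσ⟩ := exists_perm_sortStep_eq_comp (m t) (sorterState m x t)
    rw [sorterState, hσ]
    exact ih (σ i)

theorem exists_sorterState_eq_comp_restrict (x : Fin n → L) (t : ℕ) :
    ∃ f : (Finset.range t → Matching n) → Fin n → L,
      ∀ m : ℕ → Matching n, sorterState m x t = f fun s ↦ m s := by
  induction t with
  | zero => exact ⟨fun _ ↦ x, fun _ ↦ rfl⟩
  | succ t ih =>
    obtain ⟨f, hf⟩ := ih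
    have hsub : Finset.range t ⊆ Finset.range (t + 1) := Finset.range_mono t.le_succ
    exact ⟨fun g ↦ sortStep (g ⟨t, Finset.self_mem_range_succ t⟩) (f fun s ↦ g ⟨s, hsub s.2⟩),
      fun m ↦ by rw [sorterState, hf]⟩

theorem sortingTime_le {m : ℕ → Matching n} {x : Fin n → L} {t : ℕ}
    (h : Monotone (sorterState m x t)) : sortingTime m x ≤ t :=
  iInf₂_le (f := fun (s : ℕ) (_ : s ∈ {s | Monotone (sorterState m x s)}) ↦ (s : ℕ∞)) t h

theorem not_monotone_of_lt_sortingTime {m : ℕ → Matching n} {x : Fin n → L} {T : ℝ} (hT : 0 ≤ T)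
    (h : ENNReal.ofReal T < (sortingTime m x : ENNReal)) :
    ¬ Monotone (sorterState m x ⌊T⌋₊) := fun hsorted ↦ by
  refine h.not_ge ?_
  calc (sortingTime m x : ENNReal) ≤ ((⌊T⌋₊ : ℕ∞) : ENNReal) := mod_cast sortingTime_le hsorted
    _ = ENNReal.ofReal ⌊T⌋₊ := by rw [ENat.toENNReal_coe, ENNReal.ofReal_natCast]
    _ ≤ ENNReal.ofReal T := ENNReal.ofReal_le_ofReal (Nat.floor_le hT)

/-- The number of labels of the list `x` that lie below `y`. It turns labels into natural numbers
without changing their order. -/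
def labelRank {ι : Type*} [Fintype ι] (x : ι → L) (y : L) : ℕ :=
  (Finset.univ.filter fun a ↦ x a < y).card

theorem labelRank_mono {ι : Type*} [Fintype ι] (x : ι → L) : Monotone (labelRank x) :=
  fun _ _ hyz ↦ Finset.card_le_card <| Finset.monotone_filter_right _ fun _ _ h ↦ h.trans_le hyz

theorem labelRank_le_card {ι : Type*} [Fintype ι] (x : ι → L) (y : L) :
    labelRank x y ≤ Fintype.card ι :=
  Finset.card_le_univ _

theorem labelRank_lt_of_mem_range {ι : Type*} [Fintype ι] {x : ι → L} {y z : L}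
    (hy : y ∈ Set.range x) (hyz : y < z) : labelRank x y < labelRank x z := by
  obtain ⟨a, rfl⟩ := hy
  refine Finset.card_lt_card (Finset.ssubset_iff_of_subset ?_ |>.2 ⟨a, ?_, ?_⟩)
  · exact Finset.monotone_filter_right _ fun _ _ h ↦ h.trans hyz
  · simpa using hyz
  · simp

theorem monotone_of_monotone_sorterState_labelRank {m : ℕ → Matching n} {x : Fin n → L} {t : ℕ}
    (h : Monotone (sorterState m (labelRank x ∘ x) t)) : Monotone (sorterState m x t) := by
  intro i j hij
  by_contra! hlt
  rw [sorterState_comp_of_monotone (labelRank_mono x)] at h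
  exact (labelRank_lt_of_mem_range (sorterState_mem_range m x t j) hlt).not_ge (h hij)

end State

section Random

instance Matching.instFinite (n : ℕ) : Finite (Matching n) :=
  Finite.of_injective Matching.edges fun M N h ↦ by cases M; cases N; simpa using h

instance Matching.instDiscreteMeasurableSpace (n : ℕ) : DiscreteMeasurableSpace (Matching n) :=
  ⟨fun _ ↦ trivial⟩

theorem le_one_of_mem_matchingClass {n : ℕ} (hn : 2 ≤ n) {α : ℝ} {q : Measure (Matching n)}
    (hq : q ∈ MatchingClass n α) : α ≤ 1 := by
  have := hq.1
  have hedge := hq.2 ⟨0, by omega⟩ ⟨1, by omega⟩ (by simp)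
  simp only [Nat.cast_one, Nat.cast_zero, sub_zero, abs_one, div_one] at hedge
  exact hedge.trans measureReal_le_one

theorem integral_inversionWeight_sortStep_le {n : ℕ} {α : ℝ} {q : Measure (Matching n)}
    (hq : q ∈ MatchingClass n α) (x : Fin n → ℝ) :
    ∫ N, inversionWeight (sortStep N x) ∂q ≤ (1 - α) * inversionWeight x := by
  have := hq.1
  have hpair (i j : Fin n) (hij : i < j) : α * (x i - x j)⁺
      ≤ ∫ N, (if s(i, j) ∈ N.edges then (((j : ℕ) : ℝ) - (i : ℕ)) * (x i - x j)⁺ else 0) ∂q := by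
    have hdist : (0 : ℝ) < ((j : ℕ) : ℝ) - (i : ℕ) := sub_pos.2 (mod_cast hij)
    have hprob := hq.2 i j hij.ne
    rw [abs_of_pos hdist, div_le_iff₀ hdist] at hprob
    calc α * (x i - x j)⁺
        ≤ q.real {N | s(i, j) ∈ N.edges} * (((j : ℕ) : ℝ) - (i : ℕ)) * (x i - x j)⁺ :=
          mul_le_mul_of_nonneg_right hprob (posPart_nonneg _)
      _ = _ := by
          rw [mul_assoc, ← smul_eq_mul, ← integral_indicator_const _ MeasurableSet.of_discrete]
          simp only [Set.indicator_apply, Set.mem_ofPred_eq]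
  simp only [inversionWeight_sortStep]
  rw [integral_sub .of_finite .of_finite, integral_const, probReal_univ, one_smul, sub_mul, one_mul,
    integral_finsetSum _ fun _ _ ↦ .of_finite, inversionWeight, Finset.mul_sum]
  refine sub_le_sub_left (Finset.sum_le_sum fun i _ ↦ ?_) _
  rw [integral_finsetSum _ fun _ _ ↦ .of_finite, Finset.mul_sum]
  exact Finset.sum_le_sum fun j hj ↦ hpair i j (Finset.mem_Ioi.1 hj)

variable {Ω : Type*} [MeasurableSpace Ω] {μ : Measure Ω}

theorem integral_le_integral_of_indepFun [IsFiniteMeasure μ] {β γ : Type*}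
    [MeasurableSpace β] [DiscreteMeasurableSpace β] [Finite β]
    [MeasurableSpace γ] [DiscreteMeasurableSpace γ] [Finite γ]
    {X : Ω → β} {Y : Ω → γ} (hX : Measurable X) (hY : Measurable Y) (hXY : IndepFun X Y μ)
    {F : β → γ → ℝ} {G : β → ℝ} (hFG : ∀ b, ∫ c, F b c ∂μ.map Y ≤ G b) :
    ∫ ω, F (X ω) (Y ω) ∂μ ≤ ∫ ω, G (X ω) ∂μ := by
  have hlaw := (indepFun_iff_map_prod_eq_prod_map_map hX.aemeasurable hY.aemeasurable).1 hXY
  calc ∫ ω, F (X ω) (Y ω) ∂μ = ∫ p, F p.1 p.2 ∂μ.map fun ω ↦ (X ω, Y ω) :=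
        (integral_map (hX.prodMk hY).aemeasurable
          (f := fun p : β × γ ↦ F p.1 p.2) Measurable.of_discrete.aestronglyMeasurable).symm
    _ = ∫ b, ∫ c, F b c ∂μ.map Y ∂μ.map X := by rw [hlaw, integral_prod _ .of_finite]
    _ ≤ ∫ b, G b ∂μ.map X := integral_mono .of_finite .of_finite hFG
    _ = ∫ ω, G (X ω) ∂μ :=
        integral_map hX.aemeasurable Measurable.of_discrete.aestronglyMeasurable

variable {n : ℕ} {M : ℕ → Ω → Matching n}

theorem integrable_comp_sorterState [IsFiniteMeasure μ] {L : Type*} [LinearOrder L]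
    (hmeas : ∀ t, Measurable (M t)) (x : Fin n → L) (t : ℕ) (g : (Fin n → L) → ℝ) :
    Integrable (fun ω ↦ g (sorterState (fun s ↦ M s ω) x t)) μ := by
  obtain ⟨f, hf⟩ := exists_sorterState_eq_comp_restrict x t
  simp only [hf]
  exact (Integrable.of_finite (f := fun h ↦ g (f h))).comp_measurable
    (measurable_pi_lambda _ fun s : Finset.range t ↦ hmeas s)

variable [IsProbabilityMeasure μ] {α : ℝ}

theorem integral_inversionWeight_sorterState_succ_le (hmeas : ∀ t, Measurable (M t))
    (hindep : iIndepFun M μ) (x : Fin n → ℝ) {t : ℕ} (hlaw : μ.map (M t) ∈ MatchingClass n α) :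
    ∫ ω, inversionWeight (sorterState (fun s ↦ M s ω) x (t + 1)) ∂μ
      ≤ (1 - α) * ∫ ω, inversionWeight (sorterState (fun s ↦ M s ω) x t) ∂μ := by
  obtain ⟨f, hf⟩ := exists_sorterState_eq_comp_restrict x t
  have hpast : IndepFun (fun ω (s : Finset.range t) ↦ M s ω) (M t) μ :=
    (hindep.indepFun_finset (Finset.range t) {t} (by simp) hmeas).comp
      (ψ := fun g : ({t} : Finset ℕ) → Matching n ↦ g ⟨t, Finset.mem_singleton_self t⟩)
      measurable_id Measurable.of_discrete
  simp only [sorterState, hf, ← integral_const_mul]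
  exact integral_le_integral_of_indepFun (F := fun g N ↦ inversionWeight (sortStep N (f g)))
    (measurable_pi_lambda _ fun s : Finset.range t ↦ hmeas s) (hmeas t) hpast
    fun g ↦ integral_inversionWeight_sortStep_le hlaw (f g)

theorem integral_inversionWeight_sorterState_le (hmeas : ∀ t, Measurable (M t))
    (hindep : iIndepFun M μ) (hlaw : ∀ t, μ.map (M t) ∈ MatchingClass n α) (hα : α ≤ 1)
    (x : Fin n → ℝ) (t : ℕ) :
    ∫ ω, inversionWeight (sorterState (fun s ↦ M s ω) x t) ∂μ
      ≤ (1 - α) ^ t * inversionWeight x := by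
  induction t with
  | zero => simp [sorterState]
  | succ t ih =>
    calc _ ≤ (1 - α) * ∫ ω, inversionWeight (sorterState (fun s ↦ M s ω) x t) ∂μ :=
          integral_inversionWeight_sorterState_succ_le hmeas hindep x (hlaw t)
      _ ≤ (1 - α) * ((1 - α) ^ t * inversionWeight x) :=
          mul_le_mul_of_nonneg_left ih (sub_nonneg.2 hα)
      _ = (1 - α) ^ (t + 1) * inversionWeight x := by ring

theorem measureReal_not_monotone_sorterState_le {L : Type*} [LinearOrder L]
    (hmeas : ∀ t, Measurable (M t)) (hindep : iIndepFun M μ)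
    (hlaw : ∀ t, μ.map (M t) ∈ MatchingClass n α) (hα : α ≤ 1) (x : Fin n → L) (t : ℕ) :
    μ.real {ω | ¬ Monotone (sorterState (fun s ↦ M s ω) x t)} ≤ (1 - α) ^ t * n ^ 3 := by
  let r : Fin n → ℝ := fun i ↦ labelRank x (x i)
  have hr (i j : Fin n) : r i - r j ≤ n :=
    (sub_le_self _ (Nat.cast_nonneg _)).trans <| by
      simpa [r] using labelRank_le_card x (x i)
  have hunsorted (m : ℕ → Matching n) (hm : ¬ Monotone (sorterState m x t)) :
      1 ≤ inversionWeight (sorterState m r t) := by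
    have hcast : sorterState m r t = fun i ↦ ((sorterState m (labelRank x ∘ x) t i : ℕ) : ℝ) :=
      sorterState_comp_of_monotone Nat.mono_cast m (labelRank x ∘ x) t
    rw [hcast]
    exact one_le_inversionWeight_natCast (mt monotone_of_monotone_sorterState_labelRank hm)
  calc _ ≤ μ.real {ω | 1 ≤ inversionWeight (sorterState (fun s ↦ M s ω) r t)} :=
        measureReal_mono fun ω hω ↦ hunsorted _ hω
    _ ≤ ∫ ω, inversionWeight (sorterState (fun s ↦ M s ω) r t) ∂μ := by
        simpa using mul_meas_ge_le_integral_of_nonneg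
          (Filter.Eventually.of_forall fun _ ↦ inversionWeight_nonneg _)
          (integrable_comp_sorterState (μ := μ) hmeas r t inversionWeight) 1
    _ ≤ (1 - α) ^ t * inversionWeight r :=
        integral_inversionWeight_sorterState_le hmeas hindep hlaw hα r t
    _ ≤ (1 - α) ^ t * (n ^ 2 * n) :=
        mul_le_mul_of_nonneg_left (inversionWeight_le hr) (pow_nonneg (sub_nonneg.2 hα) t)
    _ = (1 - α) ^ t * n ^ 3 := by ring

end Random

theorem one_sub_pow_floor_mul_cube_le {n : ℕ} (hn : 2 ≤ n) {α : ℝ} (hα0 : 0 < α) (hα1 : α ≤ 1) :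
    (1 - α) ^ ⌊50 * Real.log n / α⌋₊ * (n : ℝ) ^ 3 ≤ 1 / (n : ℝ) ^ 2 := by
  have hn2 : (2 : ℝ) ≤ n := mod_cast hn
  have hlog : (1 / 2 : ℝ) ≤ Real.log n := by
    linarith [Real.log_two_gt_d9, Real.log_le_log two_pos hn2]
  set t := ⌊50 * Real.log n / α⌋₊
  have ht : 5 * Real.log n ≤ t * α := by
    have hfloor : 50 * Real.log n < (t + 1) * α := (div_lt_iff₀ hα0).1 (Nat.lt_floor_add_one _)
    linarith
  have hpow : (1 - α) ^ t ≤ 1 / (n : ℝ) ^ 5 :=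
    calc (1 - α) ^ t ≤ Real.exp (-α) ^ t :=
          pow_le_pow_left₀ (sub_nonneg.2 hα1) (Real.one_sub_le_exp_neg α) t
      _ = Real.exp (-(t * α)) := by rw [← Real.exp_nat_mul, mul_neg]
      _ ≤ Real.exp (-((5 : ℕ) * Real.log n)) := Real.exp_le_exp.2 (neg_le_neg (mod_cast ht))
      _ = 1 / (n : ℝ) ^ 5 := by
          rw [Real.exp_neg, Real.exp_nat_mul, Real.exp_log (by linarith), one_div]
  calc (1 - α) ^ t * (n : ℝ) ^ 3 ≤ 1 / (n : ℝ) ^ 5 * (n : ℝ) ^ 3 := by gcongr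
    _ = 1 / (n : ℝ) ^ 2 := by field_simp

theorem mainTheorem3_general {n : ℕ} (hn : 1 ≤ n) {α : ℝ} (hα : 0 < α)
    {Ω : Type*} [MeasurableSpace Ω] {μ : Measure Ω} [IsProbabilityMeasure μ]
    {M : ℕ → Ω → Matching n} (hmeas : ∀ t, Measurable (M t))
    (hlaw : ∀ t, μ.map (M t) ∈ MatchingClass n α) (hindep : iIndepFun M μ)
    {L : Type*} [LinearOrder L] (x : Fin n → L) :
    μ.real {ω | ENNReal.ofReal (50 * Real.log n / α) <
        (sortingTime (fun t ↦ M t ω) x : ENNReal)} ≤ 1 / (n : ℝ) ^ 2 := by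
  rcases hn.eq_or_lt with rfl | hn2
  · simp
  have hα1 : α ≤ 1 := le_one_of_mem_matchingClass hn2 (hlaw 0)
  have hT : 0 ≤ 50 * Real.log n / α := by positivity
  calc _ ≤ μ.real {ω | ¬ Monotone (sorterState (fun t ↦ M t ω) x ⌊50 * Real.log n / α⌋₊)} :=
        measureReal_mono fun ω hω ↦ not_monotone_of_lt_sortingTime hT hω
    _ ≤ (1 - α) ^ ⌊50 * Real.log n / α⌋₊ * (n : ℝ) ^ 3 :=
        measureReal_not_monotone_sorterState_le hmeas hindep hlaw hα1 x _
    _ ≤ 1 / (n : ℝ) ^ 2 := one_sub_pow_floor_mul_cube_le hn2 hα hα1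

theorem mainTheorem3 (n : ℕ) (hn : 1 ≤ n) (α : ℝ) (hα0 : 0 < α) (hα1 : α < 1)
    (q : Measure (Matching n)) (hq : q ∈ MatchingClass n α)
    {Ω : Type*} [MeasurableSpace Ω] (μ : Measure Ω) [IsProbabilityMeasure μ]
    (M : ℕ → Ω → Matching n) (hmeas : ∀ t, Measurable (M t))
    (hlaw : ∀ t, μ.map (M t) = q) (hindep : iIndepFun M μ)
    (x : Fin n → Fin 2) :
    μ.real {ω | ENNReal.ofReal (50 * Real.log n / α) <
        (sortingTime (fun t => M t ω) x : ENNReal)} ≤ 1 / (n : ℝ) ^ 2 :=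
  mainTheorem3_general hn hα0 hmeas (fun t ↦ (hlaw t).symm ▸ hq) hindep x
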